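/- Let $(E,(\cdot,\cdot),\mathcal H)$ be an extended affine Lie algebra over $\mathbb C$: $E$ is a complex Lie algebra, $\mathcal H\neq 0$ is a finite dimensional subalgebra, $(\cdot,\cdot)$ is a $\mathbb C$-valued symmetric bilinear form on $E$, and, with $E_\alpha=\{x\in E\mid [h,x]=\alpha(h)x\ \text{for all } h\in\mathcal H\}$ and $R=\{\alpha\in\mathcal H^\star\mid E_\alpha\neq 0\}$ (so $0\in R$), the following hold. (A1) The form is invariant and non-degenerate. (A2) $E=\sum_{\alpha\in R}E_\alpha$ and $E_0=\mathcal H$. The form is then non-degenerate on $\mathcal H$; transfer it to $\mathcal H^\star$ by $(\alpha,\beta):=(t_\alpha,t_\beta)$, where $t_\alpha\in\mathcal H$ is given by $\alpha(h)=(t_\alpha,h)$ for $h\in\mathcal H$. Let $R^0$ and $R^\times$ be the sets of $\alpha\in R$ with $(\alpha,\alpha)=0$ and with $(\alpha,\alpha)\neq0$, and let the core $E_c$ be the subalgebra generated by all $E_\alpha$, $\alpha\in R^\times$. (A3) $\mathrm{ad}(x)$ is locally nilpotent for $x\in E_\alpha$, $\alpha\in R^\times$. (A4) The centralizer of $E_c$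 in $E$ is contained in $E_c$. (A5) The $\mathbb Z$-span $\langle R\rangle$ of $R$ is a free abelian group of finite rank. (A6) $R^\times$ is not a disjoint union of two non-empty mutually orthogonal subsets. Let $\ell\ge 2$ and suppose that $R$ is of type $B_\ell$: the image of $R$ in $\mathrm{span}_{\mathbb R}R/\mathrm{span}_{\mathbb R}R^0$ is isomorphic to the finite root system of type $B_\ell$ together with $0$. A reflectable base is a set $\mathcal P\subseteq R^\times$ with $\mathcal W_{\mathcal P}\mathcal P=R^\times$ such that no proper subset of $\mathcal P$ has this property, where $\mathcal W_{\mathcal P}$ is the group generated by the reflections $w_\alpha(\beta)=\beta-\frac{2(\alpha,\beta)}{(\alpha,\alpha)}\alpha$, $\alpha\in\mathcal P$. Let $\mathrm{refl}(R)$ be the smallest cardinality of a reflectable base, put $\mathrm{ind}(R)=\mathrm{refl}(R)-\mathrm{rank}\langle R\rangle$, and suppose that $\mathrm{ind}(R)=0$. Let $\Psi$ be a Lie algebra automorphism of $E$ of finite order with $\Psi(h)=h$ for all $h\in\mathcal H$. Then: (i) $\Psi$ is diagonal, that is, it acts as a scalar on each root space $E_\alpha$, $\alpha\in R$. (ii)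 There is exactly one map $\psi:R\to\mathbb C^\times$ such that $\Psi|_{E_\alpha}=\psi(\alpha)\,\mathrm{id}$ for $\alpha\in R^\times$ and, for each $\sigma\in R^0$, $\psi(\sigma)=\psi(\alpha+\sigma)\psi(-\alpha)$ for some $\alpha\in R^\times$ with $\alpha+\sigma\in R^\times$. This map satisfies $\Psi|_{E_\alpha}=\psi(\alpha)\,\mathrm{id}$ for all $\alpha\in R$, and it is a character: $\psi(\alpha+\beta)=\psi(\alpha)\psi(\beta)$ whenever $\alpha,\beta,\alpha+\beta\in R$. -/

import Mathlib

noncomputable section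

namespace EALA

open Module

/-- The subspace `E_α = {x ∈ E | [h, x] = α(h) x for all h ∈ H}`, for `α` in the dual of a
subalgebra `H` of a complex Lie algebra `E`. -/
def rootSubspace {E : Type*} [LieRing E] [LieAlgebra ℂ E] (H : LieSubalgebra ℂ E)
    (α : Dual ℂ H) : Submodule ℂ E where
  carrier := {x | ∀ h : H, ⁅(h : E), x⁆ = α h • x}
  add_mem' := by
    intro x y hx hy h
    rw [lie_add, hx h, hy h, smul_add]
  zero_mem' := by
    intro h
    simp
  smul_mem' := by
    intro c x hx h
    rw [lie_smul, hx h, smul_comm]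

theorem mem_rootSubspace {E : Type*} [LieRing E] [LieAlgebra ℂ E] {H : LieSubalgebra ℂ E}
    {α : Dual ℂ H} {x : E} :
    x ∈ rootSubspace H α ↔ ∀ h : H, ⁅(h : E), x⁆ = α h • x := Iff.rfl

/-- A triple `(E, (·,·), H)` satisfying the first two axioms of an extended affine Lie algebra:
`H` is a non-trivial finite dimensional splitting Cartan subalgebra, and `(·,·)` is a symmetric
invariant non-degenerate bilinear form on `E`. -/
structure SplitTriple (E : Type*) [LieRing E] [LieAlgebra ℂ E] where
  /-- the Cartan subalgebra -/
  H : LieSubalgebra ℂ E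
  /-- the bilinear form -/
  form : LinearMap.BilinForm ℂ E
  H_ne_bot : H ≠ ⊥
  H_finite : FiniteDimensional ℂ H
  form_symm : ∀ x y : E, form x y = form y x
  form_invariant : ∀ x y z : E, form ⁅x, y⁆ z = form x ⁅y, z⁆
  form_nondegenerate : form.Nondegenerate
  iSup_rootSubspace : ⨆ α : Dual ℂ H, rootSubspace H α = ⊤
  rootSubspace_zero : rootSubspace H 0 = H.toSubmodule

namespace SplitTriple

variable {E : Type*} [LieRing E] [LieAlgebra ℂ E] (T : SplitTriple E)

/-- The root space `E_α`. -/
abbrev rootSpace (α : Dual ℂ T.H) : Submodule ℂ E := rootSubspace T.H α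

/-- The root system `R = {α ∈ H^* | E_α ≠ 0}`; it contains `0`. -/
def roots : Set (Dual ℂ T.H) := {α | T.rootSpace α ≠ ⊥}

/-- The form restricted to `H`. -/
def formH : LinearMap.BilinForm ℂ T.H :=
  T.form.domRestrict₁₂ T.H.toSubmodule T.H.toSubmodule

theorem formH_apply (h k : T.H) : T.formH h k = T.form h k := rfl

theorem formH_nondegenerate : T.formH.Nondegenerate := by
  have key : ∀ h : T.H, (∀ k : T.H, T.form h k = 0) → h = 0 := by
    intro h hh
    have hall : (⊤ : Submodule ℂ E) ≤ LinearMap.ker (T.form (h : E)) := by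
      rw [← T.iSup_rootSubspace]
      refine iSup_le fun α x hx => ?_
      rw [LinearMap.mem_ker]
      by_cases hα : α = 0
      · subst hα
        rw [T.rootSubspace_zero] at hx
        exact hh ⟨x, hx⟩
      · obtain ⟨k, hk⟩ : ∃ k, α k ≠ 0 := by
          by_contra hcon
          push Not at hcon
          exact hα (LinearMap.ext hcon)
        have hmem : (h : E) ∈ rootSubspace T.H 0 := by
          rw [T.rootSubspace_zero]
          exact h.2
        have h0 : ⁅(k : E), (h : E)⁆ = 0 := by
          simpa using hmem k
        have h1 : ⁅(h : E), (k : E)⁆ = 0 := by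
          rw [← lie_skew, h0, neg_zero]
        have h2 := T.form_invariant h k x
        rw [h1, hx k] at h2
        simpa [hk] using h2.symm
    have hz : (h : E) = 0 :=
      T.form_nondegenerate.1 _ fun y => LinearMap.mem_ker.1 (hall (Submodule.mem_top (x := y)))
    exact Subtype.ext hz
  refine ⟨fun h hh => key h hh, fun h hh => key h fun k => ?_⟩
  rw [T.form_symm]
  exact hh k

/-- The element `t_α ∈ H` determined by `(t_α, h) = α(h)` for all `h ∈ H`. -/
def t (α : Dual ℂ T.H) : T.H :=
  haveI := T.H_finite
  (T.formH.toDual T.formH_nondegenerate).symm α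

theorem form_t (α : Dual ℂ T.H) (h : T.H) : T.form (T.t α) h = α h := by
  have := T.H_finite
  exact LinearMap.BilinForm.apply_toDual_symm_apply (hB := T.formH_nondegenerate) α h

/-- The form on `H^*` given by `(α, β) = (t_α, t_β)`. -/
def dualForm (α β : Dual ℂ T.H) : ℂ := T.form (T.t α) (T.t β)

theorem dualForm_eq (α β : Dual ℂ T.H) : T.dualForm α β = β (T.t α) := by
  rw [dualForm, T.form_symm, T.form_t]

/-- The set `R^0` of isotropic roots. -/
def isotropicRoots : Set (Dual ℂ T.H) := {α | α ∈ T.roots ∧ T.dualForm α α = 0}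

/-- The set `R^×` of non-isotropic roots. -/
def nonisotropicRoots : Set (Dual ℂ T.H) := {α | α ∈ T.roots ∧ T.dualForm α α ≠ 0}

/-- The core `E_c`: the subalgebra generated by the non-isotropic root spaces. -/
def core : LieSubalgebra ℂ E :=
  LieSubalgebra.lieSpan ℂ E {x | ∃ α ∈ T.nonisotropicRoots, x ∈ T.rootSpace α}

/-- The root lattice `⟨R⟩`, the `ℤ`-span of `R`. -/
def rootLattice : Submodule ℤ (Dual ℂ T.H) := Submodule.span ℤ T.roots

end SplitTriple

/-- The structure of an extended affine Lie algebra on the complex Lie algebra `E`. -/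
structure ExtendedAffine (E : Type*) [LieRing E] [LieAlgebra ℂ E] extends SplitTriple E where
  ad_locally_nilpotent : ∀ α ∈ toSplitTriple.nonisotropicRoots, ∀ x ∈ toSplitTriple.rootSpace α,
    ∀ y : E, ∃ n : ℕ, ((LieAlgebra.ad ℂ E x) ^ n) y = 0
  tame : ∀ x : E, (∀ y ∈ toSplitTriple.core, ⁅x, y⁆ = 0) → x ∈ toSplitTriple.core
  rootLattice_free : Module.Free ℤ toSplitTriple.rootLattice
  rootLattice_finite : Module.Finite ℤ toSplitTriple.rootLattice
  indecomposable : ∀ R₁ R₂ : Set (Dual ℂ H), R₁ ∪ R₂ = toSplitTriple.nonisotropicRoots →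
    Disjoint R₁ R₂ → R₁.Nonempty → R₂.Nonempty →
    ∃ α ∈ R₁, ∃ β ∈ R₂, toSplitTriple.dualForm α β ≠ 0

namespace SplitTriple

variable {E : Type*} [LieRing E] [LieAlgebra ℂ E] (T : SplitTriple E)

/-! ### Type -/

/-- `V`, the real span of `R`. -/
def V : Submodule ℝ (Dual ℂ T.H) := Submodule.span ℝ T.roots

/-- `V^0`, the real span of `R^0`, as a subspace of `V`. -/
def V0 : Submodule ℝ T.V := (Submodule.span ℝ T.isotropicRoots).submoduleOf T.V

/-- The image of `R` in `V / V^0`. -/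
def rootsBar : Set (T.V ⧸ T.V0) := {v | ∃ α : T.V, (α : Dual ℂ T.H) ∈ T.roots ∧ T.V0.mkQ α = v}

end SplitTriple

/-- The finite root system of type `B_ℓ` in `ℝ^ℓ` (without `0`): the short roots `± e_i` and
the long roots `± e_i ± e_j`, `i ≠ j`. -/
def rootsB (l : ℕ) : Set (Fin l → ℝ) :=
  {v | ∃ i, ∃ a : ℝ, (a = 1 ∨ a = -1) ∧ v = a • Pi.single i 1} ∪
  {v | ∃ i j, i ≠ j ∧ ∃ a b : ℝ, (a = 1 ∨ a = -1) ∧ (b = 1 ∨ b = -1) ∧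
    v = a • Pi.single i 1 + b • Pi.single j 1}

namespace SplitTriple

variable {E : Type*} [LieRing E] [LieAlgebra ℂ E] (T : SplitTriple E)

/-- `R` is of type `B_ℓ`, `ℓ ≥ 2`: the image of `R` in `V / V^0`, which contains `0`, is
isomorphic to the root system of type `B_ℓ` together with `0`. -/
def IsTypeB (l : ℕ) : Prop :=
  2 ≤ l ∧ ∃ e : (T.V ⧸ T.V0) ≃ₗ[ℝ] (Fin l → ℝ), e '' T.rootsBar = insert 0 (rootsB l)

/-! ### Reflectable bases and index -/

/-- The reflection `w_α(β) = β - (2 (α, β) / (α, α)) α` of `H^*`, for non-isotropic `α`. -/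
def reflection (α : Dual ℂ T.H) (hα : T.dualForm α α ≠ 0) : Dual ℂ T.H ≃ₗ[ℂ] Dual ℂ T.H :=
  Module.reflection (x := α) (f := (2 / T.dualForm α α) • Dual.eval ℂ T.H (T.t α)) (by
    rw [LinearMap.smul_apply, Dual.eval_apply, ← T.dualForm_eq, smul_eq_mul,
      div_mul_cancel₀ _ hα])

theorem reflection_apply (α : Dual ℂ T.H) (hα : T.dualForm α α ≠ 0) (β : Dual ℂ T.H) :
    T.reflection α hα β = β - (2 * T.dualForm α β / T.dualForm α α) • α := by
  rw [reflection, Module.reflection_apply, LinearMap.smul_apply, Dual.eval_apply,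
    ← T.dualForm_eq, smul_eq_mul, div_mul_eq_mul_div]

/-- The group `W_P` generated by the reflections in the non-isotropic elements of `P`. -/
def weylGroup (P : Set (Dual ℂ T.H)) : Subgroup (Dual ℂ T.H ≃ₗ[ℂ] Dual ℂ T.H) :=
  Subgroup.closure {w | ∃ α ∈ P, ∃ hα : T.dualForm α α ≠ 0, w = T.reflection α hα}

/-- The set `W_P P`. -/
def weylOrbit (P : Set (Dual ℂ T.H)) : Set (Dual ℂ T.H) :=
  {β | ∃ w ∈ T.weylGroup P, ∃ α ∈ P, w α = β}

/-- `P ⊆ R^×` is a reflectable base: `W_P P = R^×` and no proper subset of `P` has this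
property. -/
def IsReflectableBase (P : Set (Dual ℂ T.H)) : Prop :=
  P ⊆ T.nonisotropicRoots ∧ T.weylOrbit P = T.nonisotropicRoots ∧
    ∀ Q, Q ⊂ P → T.weylOrbit Q ≠ T.nonisotropicRoots

/-- `refl(R)`, the smallest cardinality of a reflectable base (`⊤` if there is no finite one). -/
def refl : ℕ∞ := ⨅ P ∈ {P : Set (Dual ℂ T.H) | T.IsReflectableBase P}, P.encard

/-- `ind(R) = refl(R) - rank ⟨R⟩`. -/
def index : ℤ := (T.refl.toNat : ℤ) - (Module.finrank ℤ T.rootLattice : ℤ)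

/-! ### Cartan automorphisms and characters -/

/-- A Cartan automorphism fixes `H` pointwise. -/
def IsCartanAutomorphism (Ψ : E ≃ₗ⁅ℂ⁆ E) : Prop := ∀ h ∈ T.H, Ψ h = h

/-- `Ψ` acts as a scalar on each root space. -/
def IsDiagonal (Ψ : E ≃ₗ⁅ℂ⁆ E) : Prop :=
  ∀ α ∈ T.roots, ∃ c : ℂ, ∀ x ∈ T.rootSpace α, Ψ x = c • x

/-- `ψ : R → ℂ^×` is the map associated to `Ψ`: for `α ∈ R^×`, `Ψ` acts on `E_α` as `ψ(α)`, and
for `σ ∈ R^0`, `ψ(σ) = ψ(α + σ) ψ(-α)` for some `α ∈ R^×` with `α + σ ∈ R^×`. (That the choice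
of `α` does not matter is the uniqueness of such a `ψ`.) -/
def IsAssociatedMap (Ψ : E ≃ₗ⁅ℂ⁆ E) (ψ : T.roots → ℂˣ) : Prop :=
  (∀ α : T.roots, (α : Dual ℂ T.H) ∈ T.nonisotropicRoots →
    ∀ x ∈ T.rootSpace α, Ψ x = (ψ α : ℂ) • x) ∧
  (∀ σ : T.roots, (σ : Dual ℂ T.H) ∈ T.isotropicRoots →
    ∃ α α' β : T.roots, (α : Dual ℂ T.H) ∈ T.nonisotropicRoots ∧
      (β : Dual ℂ T.H) ∈ T.nonisotropicRoots ∧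
      (α' : Dual ℂ T.H) = -α ∧ (β : Dual ℂ T.H) = α + σ ∧ ψ σ = ψ β * ψ α')

/-- `ψ` is a character: `ψ(α + β) = ψ(α) ψ(β)` whenever `α, β, α + β ∈ R`. -/
def IsCharacter (ψ : T.roots → ℂˣ) : Prop :=
  ∀ α β γ : T.roots, (γ : Dual ℂ T.H) = α + β → ψ γ = ψ α * ψ β

end SplitTriple

/-- `Ψ^m = id` for some `m > 0`. -/
def IsFiniteOrder {E : Type*} [LieRing E] [LieAlgebra ℂ E] (Ψ : E ≃ₗ⁅ℂ⁆ E) : Prop :=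
  ∃ m : ℕ, 0 < m ∧ (⇑Ψ)^[m] = id

end EALA

end

/-! A root space `E_α` with `α` non-isotropic is a line (`exists_eq_smul`), so `Ψ` is a scalar on
it. A minimal reflectable base `P` spans the root lattice (`span_eq_rootLattice`). Index zero says
that `P` has as many elements as the rank, so `P` is a `ℤ`-basis, and the scalars of `Ψ` on the
`E_α`, `α ∈ P`, extend to a character `χ` of the lattice. Reflections are realised by powers of `ad
f` on root vectors, and these respect `χ`; hence `Ψ = χ(β)` on `E_β` for every `β ∈ W_P P = R^×`,
and then `χ` governs `Ψ` on the whole core.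

For isotropic `σ` and `x ∈ E_σ`, the defect `y = Ψx - χ(σ)x` centralises the core, so tameness puts
it in the core, where `Ψy = χ(σ)y`. A nonzero `y` would give `Ψ` a nontrivial Jordan block, which
finite order forbids (`rootSpace_le_scalarSpace`).

That isotropic roots are differences of non-isotropic ones (`exists_nonisotropic_translate`) also
follows from tameness. It gives both the spanning of the lattice and the existence of the associated
map. -/

namespace EALA

open Module

/-! ### Raising and lowering operators: `sl₂` for `b = 1`, Heisenberg for `b = 0`. -/

section Operators

variable {M : Type*} [AddCommGroup M] [Module ℂ M] {A B H : End ℂ M} {b : ℂ}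

theorem weight_pow (hHA : ∀ x, H (A x) = A (H x) + (2 * b) • A x) {x : M} {μ : ℂ}
    (hx : H x = μ • x) (j : ℕ) : H ((A ^ j) x) = (μ + 2 * b * j) • (A ^ j) x := by
  induction j with
  | zero => simp [hx]
  | succ j ih =>
    rw [pow_succ', Module.End.mul_apply, hHA, ih, map_smul, ← add_smul]
    push_cast
    congr 1
    ring

/-- Moving `B` to the left past each `A` contributes the weights `μ + 2bi`, `0 ≤ i ≤ j`, whose sum
is `(j + 1)(μ + bj)`. -/
theorem pow_succ_apply_lowering (hAB : ∀ x, A (B x) = B (A x) + H x)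
    (hHA : ∀ x, H (A x) = A (H x) + (2 * b) • A x) {x : M} {μ : ℂ}
    (hx : H x = μ • x) (j : ℕ) :
    (A ^ (j + 1)) (B x) = B ((A ^ (j + 1)) x) + (((j : ℂ) + 1) * (μ + b * j)) • (A ^ j) x := by
  induction j with
  | zero => simp [hAB, hx]
  | succ j ih =>
    rw [pow_succ', Module.End.mul_apply, ih, map_add, map_smul, hAB, weight_pow hHA hx,
      ← Module.End.mul_apply A, ← pow_succ', ← Module.End.mul_apply A, ← pow_succ', add_assoc,
      ← add_smul]
    push_cast
    congr 2
    ring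

/-- Since `A ^ (j + 1)` kills `x`, the previous identity loses its first term, and `B x` satisfies
the same hypotheses with `j + 1` and `μ - 2b`. The difference `μ + bj` thus drops by `b` at each
application of `B`. -/
theorem pow_add_apply_lowering_pow (hAB : ∀ x, A (B x) = B (A x) + H x)
    (hHA : ∀ x, H (A x) = A (H x) + (2 * b) • A x)
    (hHB : ∀ x, H (B x) = B (H x) - (2 * b) • B x) (n : ℕ) :
    ∀ (x : M) (μ : ℂ) (j : ℕ), H x = μ • x → (A ^ (j + 1)) x = 0 →
      (A ^ (j + n)) ((B ^ n) x) =
        (∏ i ∈ Finset.range n, ((j : ℂ) + i + 1) * (μ + b * (j - i))) • (A ^ j) x := by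
  induction n with
  | zero => intro x μ j _ _; simp
  | succ n ih =>
    intro x μ j hx hj
    have h1 := pow_succ_apply_lowering hAB hHA hx j
    rw [hj, map_zero, zero_add] at h1
    have h2 : (A ^ (j + 1 + 1)) (B x) = 0 := by
      rw [pow_succ', Module.End.mul_apply, h1, map_smul, ← Module.End.mul_apply A, ← pow_succ', hj,
        smul_zero]
    have h3 : H (B x) = (μ - 2 * b) • B x := by
      rw [hHB, hx, map_smul, sub_smul]
    have h4 := ih (B x) (μ - 2 * b) (j + 1) h3 h2
    rw [pow_succ, Module.End.mul_apply, show j + (n + 1) = j + 1 + n by ring, h4, h1, smul_smul,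
      Finset.prod_range_succ']
    congr 1
    congr 1
    · refine Finset.prod_congr rfl fun i _ => ?_
      push_cast
      ring
    · push_cast
      ring

/-- A weight vector killed by powers of the raising and of the lowering operator vanishes, unless
one of the structure constants does. -/
theorem eq_zero_of_pow_eq_zero (hAB : ∀ x, A (B x) = B (A x) + H x)
    (hHA : ∀ x, H (A x) = A (H x) + (2 * b) • A x)
    (hHB : ∀ x, H (B x) = B (H x) - (2 * b) • B x) {x : M} {μ : ℂ} (hx : H x = μ • x) {k n : ℕ}
    (hA : (A ^ k) x = 0) (hB : (B ^ n) x = 0)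
    (hne : ∀ i < n, ∀ j : ℕ, μ + b * (j - i) ≠ 0) : x = 0 := by
  induction k with
  | zero => simpa using hA
  | succ k ih =>
    -- Downward induction on the power of `A`: the string identity makes a nonzero multiple of `(A ^
    -- k) x` vanish.
    refine ih ?_
    have h := pow_add_apply_lowering_pow hAB hHA hHB n x μ k hx hA
    rw [hB, map_zero] at h
    refine (smul_eq_zero.1 h.symm).resolve_left ?_
    refine Finset.prod_ne_zero_iff.2 fun i hi => mul_ne_zero ?_ (hne i (Finset.mem_range.1 hi) k)
    exact_mod_cast Nat.succ_ne_zero (k + i)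

end Operators

/-! ### Root spaces, their grading and the form. -/

namespace SplitTriple

variable {E : Type*} [LieRing E] [LieAlgebra ℂ E] (T : SplitTriple E)

theorem dualForm_comm (α β : Dual ℂ T.H) : T.dualForm α β = T.dualForm β α :=
  T.form_symm _ _

theorem dualForm_add_right (α β γ : Dual ℂ T.H) :
    T.dualForm α (β + γ) = T.dualForm α β + T.dualForm α γ := by
  simp [dualForm_eq]

theorem dualForm_smul_right (c : ℂ) (α β : Dual ℂ T.H) :
    T.dualForm α (c • β) = c * T.dualForm α β := by
  simp [dualForm_eq]

theorem dualForm_neg_right (α β : Dual ℂ T.H) : T.dualForm α (-β) = -T.dualForm α β := by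
  simp [dualForm_eq]

theorem dualForm_sub_right (α β γ : Dual ℂ T.H) :
    T.dualForm α (β - γ) = T.dualForm α β - T.dualForm α γ := by
  simp [dualForm_eq]

theorem dualForm_add_left (α β γ : Dual ℂ T.H) :
    T.dualForm (α + β) γ = T.dualForm α γ + T.dualForm β γ := by
  simp only [T.dualForm_comm _ γ, dualForm_add_right]

theorem dualForm_smul_left (c : ℂ) (α β : Dual ℂ T.H) :
    T.dualForm (c • α) β = c * T.dualForm α β := by
  simp only [T.dualForm_comm _ β, dualForm_smul_right]

theorem dualForm_neg_left (α β : Dual ℂ T.H) : T.dualForm (-α) β = -T.dualForm α β := by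
  simp only [T.dualForm_comm _ β, dualForm_neg_right]

theorem dualForm_sub_left (α β γ : Dual ℂ T.H) :
    T.dualForm (α - β) γ = T.dualForm α γ - T.dualForm β γ := by
  simp only [T.dualForm_comm _ γ, dualForm_sub_right]

variable {T} {α β : Dual ℂ T.H} {x y : E}

theorem mem_roots_of_ne_zero (hx : x ∈ T.rootSpace α) (h : x ≠ 0) : α ∈ T.roots :=
  fun h0 => h (by simpa [h0] using hx)

theorem exists_ne_zero_of_mem_roots (hα : α ∈ T.roots) : ∃ x ∈ T.rootSpace α, x ≠ 0 :=
  Submodule.exists_mem_ne_zero_of_ne_bot hα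

theorem lie_mem_rootSpace (hx : x ∈ T.rootSpace α) (hy : y ∈ T.rootSpace β) :
    ⁅x, y⁆ ∈ T.rootSpace (α + β) := by
  intro h
  rw [leibniz_lie, hx h, hy h, smul_lie, lie_smul, ← add_smul, LinearMap.add_apply]

theorem ad_pow_mem_rootSpace (hx : x ∈ T.rootSpace α) (hy : y ∈ T.rootSpace β) (n : ℕ) :
    ((LieAlgebra.ad ℂ E x) ^ n) y ∈ T.rootSpace (β + n • α) := by
  induction n with
  | zero => simpa using hy
  | succ n ih =>
    rw [pow_succ', Module.End.mul_apply, LieAlgebra.ad_apply,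
      show β + (n + 1) • α = α + (β + n • α) by rw [succ_nsmul]; abel]
    exact lie_mem_rootSpace hx ih

theorem form_eq_zero (hx : x ∈ T.rootSpace α) (hy : y ∈ T.rootSpace β) (h : α + β ≠ 0) :
    T.form x y = 0 := by
  obtain ⟨k, hk⟩ := DFunLike.ne_iff.1 h
  have h1 := T.form_invariant x k y
  rw [← lie_skew, hx k, hy k, map_neg, map_smul, map_smul, LinearMap.neg_apply,
    LinearMap.smul_apply, smul_eq_mul, smul_eq_mul] at h1
  have h2 : (α k + β k) * T.form x y = 0 := by linear_combination -h1
  exact (mul_eq_zero.1 h2).resolve_left hk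

theorem exists_form_ne_zero (hx : x ∈ T.rootSpace α) (h : x ≠ 0) :
    ∃ y ∈ T.rootSpace (-α), T.form x y ≠ 0 := by
  by_contra! hcon
  refine h (T.form_nondegenerate.1 _ fun y => ?_)
  have hall : (⊤ : Submodule ℂ E) ≤ LinearMap.ker (T.form x) := by
    rw [← T.iSup_rootSubspace]
    refine iSup_le fun β z hz => ?_
    rw [LinearMap.mem_ker]
    by_cases hβ : α + β = 0
    · obtain rfl : β = -α := (neg_eq_of_add_eq_zero_right hβ).symm
      exact hcon z hz
    · exact form_eq_zero hx hz hβ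
  exact LinearMap.mem_ker.1 (hall (Submodule.mem_top (x := y)))

theorem neg_mem_roots (hα : α ∈ T.roots) : -α ∈ T.roots := by
  obtain ⟨x, hx, h⟩ := exists_ne_zero_of_mem_roots hα
  obtain ⟨y, hy, hxy⟩ := exists_form_ne_zero hx h
  exact mem_roots_of_ne_zero hy fun h0 => hxy (by simp [h0])

theorem neg_mem_nonisotropicRoots (hα : α ∈ T.nonisotropicRoots) :
    -α ∈ T.nonisotropicRoots :=
  ⟨neg_mem_roots hα.1, by simpa [dualForm_neg_left, dualForm_neg_right] using hα.2⟩

/-- The bracket lies in `E_0 = H`, and by invariance its pairing with `k ∈ H` is `(x, y) α(k)`; the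
form is non-degenerate on `H`. -/
theorem lie_eq_form_smul_t (hx : x ∈ T.rootSpace α) (hy : y ∈ T.rootSpace (-α)) :
    ⁅x, y⁆ = T.form x y • (T.t α : E) := by
  have hmem : ⁅x, y⁆ ∈ T.H := by
    have := lie_mem_rootSpace hx hy
    rw [add_neg_cancel] at this
    change _ ∈ rootSubspace T.H 0 at this
    rwa [T.rootSubspace_zero] at this
  have key : (⟨⁅x, y⁆, hmem⟩ : T.H) - T.form x y • T.t α = 0 := by
    refine T.formH_nondegenerate.1 _ fun k => ?_
    rw [map_sub, map_smul, LinearMap.sub_apply, LinearMap.smul_apply, formH_apply, formH_apply,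
      form_t, T.form_invariant, ← lie_skew, hy k]
    simp [mul_comm]
  simpa using congrArg Subtype.val (sub_eq_zero.1 key)

theorem t_lie (hx : x ∈ T.rootSpace β) : ⁅(T.t α : E), x⁆ = T.dualForm α β • x := by
  rw [dualForm_eq]
  exact hx _

/-- Root spaces lie in simultaneous generalised eigenspaces of the commuting operators `ad h`. -/
theorem iSupIndep_rootSpace : iSupIndep T.rootSpace := by
  have hcomm (h k : T.H) : Commute (LieAlgebra.ad ℂ E h) (LieAlgebra.ad ℂ E k) := by
    have hk : (k : E) ∈ rootSubspace T.H 0 := by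
      rw [T.rootSubspace_zero]
      exact k.2
    have h0 : ⁅(h : E), (k : E)⁆ = 0 := by simpa using hk h
    refine LinearMap.ext fun z => ?_
    simp only [Module.End.mul_apply, LieAlgebra.ad_apply]
    rw [leibniz_lie, h0, zero_lie, zero_add]
  have hind := Module.End.independent_iInf_maxGenEigenspace_of_forall_mapsTo
    (fun h : T.H => LieAlgebra.ad ℂ E h)
    fun h k φ => Module.End.mapsTo_maxGenEigenspace_of_comm (hcomm k h) φ
  refine (hind.comp (f := fun α : Dual ℂ T.H => (α : T.H → ℂ)) DFunLike.coe_injective).mono ?_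
  intro α x hx
  rw [Function.comp_apply, Module.End.mem_iInf_maxGenEigenspace_iff]
  exact fun h => ⟨1, by simp [hx h]⟩

/-- `eq_zero_of_pow_eq_zero` for root vectors `e`, `f` of opposite degrees. -/
theorem eq_zero_of_ad_pow_eq_zero {e f : E} (he : e ∈ T.rootSpace α)
    (hf : f ∈ T.rootSpace (-α)) {b : ℂ} (hb : T.form e f * T.dualForm α α = 2 * b)
    (hx : x ∈ T.rootSpace β) {k n : ℕ} (hk : ((LieAlgebra.ad ℂ E e) ^ k) x = 0)
    (hn : ((LieAlgebra.ad ℂ E f) ^ n) x = 0)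
    (hne : ∀ i < n, ∀ j : ℕ, T.form e f * T.dualForm α β + b * (j - i) ≠ 0) : x = 0 := by
  refine eq_zero_of_pow_eq_zero (A := LieAlgebra.ad ℂ E e) (B := LieAlgebra.ad ℂ E f)
    (H := LieAlgebra.ad ℂ E ⁅e, f⁆) (b := b) (fun z => ?_) (fun z => ?_) (fun z => ?_) ?_ hk hn hne
  · simp
  · have h : ⁅⁅e, f⁆, e⁆ = (2 * b) • e := by
      rw [lie_eq_form_smul_t he hf, smul_lie, t_lie he, smul_smul, hb]
    simp only [LieAlgebra.ad_apply]
    rw [leibniz_lie, h, smul_lie, add_comm]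
  · have h : ⁅⁅e, f⁆, f⁆ = -((2 * b) • f) := by
      rw [lie_eq_form_smul_t he hf, smul_lie, t_lie hf, smul_smul, dualForm_neg_right, ← hb,
        mul_neg, neg_smul]
    simp only [LieAlgebra.ad_apply]
    rw [leibniz_lie, h, neg_lie, smul_lie]
    abel
  · rw [LieAlgebra.ad_apply, lie_eq_form_smul_t he hf, smul_lie, t_lie hx, smul_smul]

end SplitTriple

/-! ### Bases and characters of lattices. -/

section Lattice

/-- A surjection between free modules of the same finite rank is injective. -/
theorem linearIndependent_of_span_eq_of_encard_eq {M : Type*} [AddCommGroup M]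
    {L : Submodule ℤ M} [Module.Free ℤ L] [Module.Finite ℤ L] {P : Set M}
    (hspan : Submodule.span ℤ P = L) (hcard : P.encard = Module.finrank ℤ L) :
    LinearIndependent ℤ ((↑) : P → M) := by
  have hPfin : P.Finite := Set.finite_of_encard_eq_coe hcard
  have := hPfin.fintype
  have hrange : LinearMap.range (Finsupp.linearCombination ℤ ((↑) : P → M)) = L := by
    rw [Finsupp.range_linearCombination, Subtype.range_coe, hspan]
  have hn : Module.finrank ℤ (P →₀ ℤ) = Module.finrank ℤ L := by
    rw [Module.finrank_finsupp_self]
    rw [← Set.coe_fintypeCard] at hcard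
    exact_mod_cast hcard
  let g : (P →₀ ℤ) →ₗ[ℤ] L := (Finsupp.linearCombination ℤ ((↑) : P → M)).codRestrict L
    fun c => hrange ▸ LinearMap.mem_range_self _ c
  have hg : Function.Surjective g := by
    rintro ⟨v, hv⟩
    rw [← hrange] at hv
    obtain ⟨c, rfl⟩ := hv
    exact ⟨c, rfl⟩
  let φ : L ≃ₗ[ℤ] (P →₀ ℤ) := LinearEquiv.ofFinrankEq _ _ hn.symm
  have hinj : Function.Injective (φ.toLinearMap ∘ₗ g) :=
    OrzechProperty.injective_of_surjective_endomorphism _ (by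
      rw [LinearMap.coe_comp]
      exact φ.surjective.comp hg)
  intro c d hcd
  refine hinj ?_
  exact congrArg φ (Subtype.ext hcd)

/-- A function on a `ℤ`-basis of a lattice extends to a character of the lattice. -/
theorem exists_character {M : Type*} [AddCommGroup M] {G : Type*} [CommGroup G]
    {L : Submodule ℤ M} {P : Set M} (hspan : Submodule.span ℤ P = L)
    (hind : LinearIndependent ℤ ((↑) : P → M)) (g : M → G) :
    ∃ χ : M → G, (∀ a ∈ L, ∀ b ∈ L, χ (a + b) = χ a * χ b) ∧ ∀ a ∈ P, χ a = g a := by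
  classical
  let B := Basis.span hind
  let f := B.constr ℤ (fun p : P => Additive.ofMul (g p))
  have hL : Submodule.span ℤ (Set.range ((↑) : P → M)) = L := by rw [Subtype.range_coe, hspan]
  subst hL
  -- The value `1` outside `L` is a default; nothing is claimed there.
  refine ⟨fun a => if h : a ∈ Submodule.span ℤ (Set.range ((↑) : P → M)) then
    (f ⟨a, h⟩).toMul else 1, fun a ha b hb => ?_, fun a ha => ?_⟩
  · simp only [ha, hb, add_mem ha hb, dite_true]
    rw [← toMul_add, ← map_add]
    rfl
  · have hmem : a ∈ Submodule.span ℤ (Set.range ((↑) : P → M)) :=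
      Submodule.subset_span ⟨⟨a, ha⟩, rfl⟩
    simp only [hmem, dite_true]
    have : (⟨a, hmem⟩ : Submodule.span ℤ (Set.range ((↑) : P → M))) = B ⟨a, ha⟩ :=
      (Basis.span_apply hind ⟨a, ha⟩).symm
    rw [this, Basis.constr_basis]
    rfl

end Lattice

/-! ### Weyl group orbits and existence of non-isotropic roots. -/

namespace SplitTriple

variable {E : Type*} [LieRing E] [LieAlgebra ℂ E] {T : SplitTriple E} {α β : Dual ℂ T.H}

theorem weylGroup_apply_mem {P S : Set (Dual ℂ T.H)}
    (hS : ∀ α ∈ P, ∀ hα : T.dualForm α α ≠ 0, ∀ β ∈ S, T.reflection α hα β ∈ S)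
    {w : Dual ℂ T.H ≃ₗ[ℂ] Dual ℂ T.H} (hw : w ∈ T.weylGroup P) (hβ : β ∈ S) : w β ∈ S := by
  -- Inverses are carried along because the closure is that of a group; reflections are involutions.
  suffices h : (∀ β ∈ S, w β ∈ S) ∧ ∀ β ∈ S, w⁻¹ β ∈ S from h.1 β hβ
  induction hw using Subgroup.closure_induction with
  | mem w hw =>
    obtain ⟨α, hα, h, rfl⟩ := hw
    have hinv : (T.reflection α h)⁻¹ = T.reflection α h := by
      rw [reflection]
      exact Module.reflection_inv _
    rw [hinv]
    exact ⟨hS α hα h, hS α hα h⟩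
  | one => simp
  | mul v w _ _ hv hw =>
    rw [mul_inv_rev]
    exact ⟨fun β hβ => hv.1 _ (hw.1 β hβ), fun β hβ => hw.2 _ (hv.2 β hβ)⟩
  | inv w _ hw => exact ⟨hw.2, by rw [inv_inv]; exact hw.1⟩

/-- Otherwise `V = V^0`, and the quotient could not be `ℝ^ℓ` with `ℓ ≥ 2`. -/
theorem nonisotropicRoots_nonempty {l : ℕ} (hB : T.IsTypeB l) :
    T.nonisotropicRoots.Nonempty := by
  by_contra hne
  rw [Set.not_nonempty_iff_eq_empty] at hne
  have hiso : T.isotropicRoots = T.roots := by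
    refine Set.Subset.antisymm (fun α h => h.1) fun α h => ⟨h, ?_⟩
    by_contra h0
    have : α ∈ T.nonisotropicRoots := ⟨h, h0⟩
    simp [hne] at this
  have hV0 : T.V0 = ⊤ := by
    rw [V0, hiso]
    exact Submodule.submoduleOf_self _
  obtain ⟨hl, e, -⟩ := hB
  have hsub : Subsingleton (T.V ⧸ T.V0) := Submodule.Quotient.subsingleton_iff.2 hV0
  have hsub2 : Subsingleton (Fin l → ℝ) := e.symm.toEquiv.subsingleton
  have h01 := congrFun (Subsingleton.elim (0 : Fin l → ℝ) 1) ⟨0, by omega⟩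
  simp at h01

end SplitTriple

/-! ### Root strings, multiplicity one, isotropic roots and tameness. -/

namespace ExtendedAffine

variable {E : Type*} [LieRing E] [LieAlgebra ℂ E] {T : ExtendedAffine E} {α β σ : Dual ℂ T.H}
  {x y : E}

open SplitTriple

/-- The normalisation makes `e`, `[e, f]`, `f` an `sl₂`-triple, so that `b = 1` below. -/
theorem exists_dual_vector (hα : α ∈ T.nonisotropicRoots) {e : E} (he : e ∈ T.rootSpace α)
    (h : e ≠ 0) : ∃ f ∈ T.rootSpace (-α), T.form e f * T.dualForm α α = 2 := by
  obtain ⟨f, hf, hef⟩ := exists_form_ne_zero he h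
  refine ⟨(2 / (T.form e f * T.dualForm α α)) • f, Submodule.smul_mem _ _ hf, ?_⟩
  have := hα.2
  rw [map_smul, smul_eq_mul]
  field_simp

/-- The weight of `x` under `[e, f]` is `2(α, β)/(α, α)`. Both `e` and `f` act locally nilpotently,
and a non-integral weight would leave every factor nonzero. -/
theorem exists_int_two_mul_dualForm (hα : α ∈ T.nonisotropicRoots) (hβ : β ∈ T.roots) :
    ∃ z : ℤ, 2 * T.dualForm α β = z * T.dualForm α α := by
  obtain ⟨e, he, he0⟩ := exists_ne_zero_of_mem_roots hα.1
  obtain ⟨f, hf, hef⟩ := exists_dual_vector hα he he0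
  obtain ⟨x, hx, hx0⟩ := exists_ne_zero_of_mem_roots hβ
  obtain ⟨k, hk⟩ := T.ad_locally_nilpotent α hα e he x
  obtain ⟨n, hn⟩ := T.ad_locally_nilpotent (-α) (neg_mem_nonisotropicRoots hα) f hf x
  by_contra! hcon
  refine hx0 (eq_zero_of_ad_pow_eq_zero he hf (b := 1) (by rw [hef, mul_one]) hx hk hn ?_)
  intro i _ j hij
  refine hcon (i - j) ?_
  push_cast
  linear_combination T.dualForm α α * hij - T.dualForm α β * hef

/-- Subtracting a multiple of `e` leaves a vector `z` with `(z, f) = 0`, hence `[f, z] = 0`. A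
weight `2` vector cannot be killed by `f`, since the factors `2 + j` are nonzero. -/
theorem exists_eq_smul (hα : α ∈ T.nonisotropicRoots) {e : E} (he : e ∈ T.rootSpace α)
    (h : e ≠ 0) (hx : x ∈ T.rootSpace α) : ∃ c : ℂ, x = c • e := by
  obtain ⟨f, hf, hef⟩ := exists_dual_vector hα he h
  have hef0 : T.form e f ≠ 0 := fun h0 => by simp [h0] at hef
  refine ⟨T.form x f / T.form e f, sub_eq_zero.1 ?_⟩
  have hz : x - (T.form x f / T.form e f) • e ∈ T.rootSpace α :=
    Submodule.sub_mem _ hx (Submodule.smul_mem _ _ he)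
  obtain ⟨k, hk⟩ := T.ad_locally_nilpotent α hα e he (x - (T.form x f / T.form e f) • e)
  refine eq_zero_of_ad_pow_eq_zero he hf (b := 1) (n := 1) (by rw [hef, mul_one]) hz hk ?_ ?_
  · rw [pow_one, LieAlgebra.ad_apply, ← lie_skew, lie_eq_form_smul_t hz hf]
    simp [hef0]
  · intro i hi j
    obtain rfl : i = 0 := by omega
    rw [hef, Nat.cast_zero, sub_zero, one_mul]
    exact_mod_cast (by omega : 2 + j ≠ 0)

/-- In weight `n` the factors are `n + j - i` with `i < n`, all positive. This moves a root vector
from `β` to the reflected root `β - nα`. -/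
theorem ad_pow_ne_zero (hα : α ∈ T.nonisotropicRoots) {e f : E} (he : e ∈ T.rootSpace α)
    (hf : f ∈ T.rootSpace (-α)) (hef : T.form e f * T.dualForm α α = 2)
    (hx : x ∈ T.rootSpace β) (hx0 : x ≠ 0) {n : ℕ}
    (hn : 2 * T.dualForm α β = n * T.dualForm α α) : ((LieAlgebra.ad ℂ E f) ^ n) x ≠ 0 := by
  obtain ⟨k, hk⟩ := T.ad_locally_nilpotent α hα e he x
  intro h0
  refine hx0 (eq_zero_of_ad_pow_eq_zero he hf (b := 1) (by rw [hef, mul_one]) hx hk h0 ?_)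
  intro i hi j hij
  have h1 : T.form e f * T.dualForm α β = n := by
    linear_combination (T.form e f / 2) * hn + n / 2 * hef
  rw [h1] at hij
  have h2 : ((n + j : ℕ) : ℂ) = (i : ℕ) := by
    push_cast
    linear_combination hij
  have := Nat.cast_injective h2
  omega

/-- If `(α, σ) ≠ 0`, integrality bounds the `σ`-string through `α`, so vectors `e ∈ E_σ` and `f ∈
E_{-σ}` act nilpotently on `E_α`. But `[e, f]` commutes with both and acts there by a nonzero
scalar, which the Heisenberg relations exclude. -/
theorem dualForm_isotropic_nonisotropic (hσ : σ ∈ T.isotropicRoots)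
    (hα : α ∈ T.nonisotropicRoots) : T.dualForm α σ = 0 := by
  by_contra hne
  obtain ⟨k, hk⟩ := exists_int_two_mul_dualForm hα hσ.1
  have hk0 : k ≠ 0 := by
    rintro rfl
    exact hne (by simpa using hk)
  -- The norm of `α + nσ` is `(1 + nk)(α, α)`, and integrality forces `1 + nk` to divide `2 + nk`,
  -- hence `1`. The bound `3` excludes `nk = -1` (norm zero) and `nk = -2`.
  have hbound (n : ℤ) (hn : 3 ≤ |n|) : α + n • σ ∉ T.roots := by
    intro hmem
    have hnk : 3 ≤ |n * k| := by
      rw [abs_mul]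
      nlinarith [Int.one_le_abs hk0]
    have hcast : ((n : ℤ) • σ : Dual ℂ T.H) = (n : ℂ) • σ := (Int.cast_smul_eq_zsmul ℂ n σ).symm
    have hnorm : T.dualForm (α + n • σ) (α + n • σ) = ((1 + n * k : ℤ) : ℂ) * T.dualForm α α := by
      rw [hcast]
      simp only [dualForm_add_left, dualForm_add_right, dualForm_smul_left, dualForm_smul_right,
        hσ.2, T.dualForm_comm σ α]
      push_cast
      linear_combination n * hk
    have hnz : 1 + n * k ≠ 0 := by
      intro h0
      have : n * k = -1 := by omega
      rw [this] at hnk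
      norm_num at hnk
    have hγ : α + n • σ ∈ T.nonisotropicRoots :=
      ⟨hmem, by rw [hnorm]; exact mul_ne_zero (by exact_mod_cast hnz) hα.2⟩
    obtain ⟨z, hz⟩ := exists_int_two_mul_dualForm hγ hα.1
    rw [hnorm, hcast] at hz
    simp only [dualForm_add_left, dualForm_smul_left, T.dualForm_comm σ α] at hz
    have h1 : ((2 + n * k : ℤ) : ℂ) * T.dualForm α α
        = ((z * (1 + n * k) : ℤ) : ℂ) * T.dualForm α α := by
      push_cast at hz ⊢
      linear_combination hz - n * hk
    have h2 : 2 + n * k = z * (1 + n * k) := by exact_mod_cast mul_right_cancel₀ hα.2 h1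
    have h3 : (1 + n * k) ∣ 1 := ⟨z - 1, by linear_combination h2⟩
    have h4 := Int.isUnit_iff.1 (isUnit_of_dvd_one h3)
    rcases h4 with h4 | h4
    · rw [show n * k = 0 by omega] at hnk
      norm_num at hnk
    · rw [show n * k = -2 by omega] at hnk
      norm_num at hnk
  obtain ⟨e, he, he0⟩ := exists_ne_zero_of_mem_roots hσ.1
  obtain ⟨f, hf, hef⟩ := exists_form_ne_zero he he0
  obtain ⟨x, hx, hx0⟩ := exists_ne_zero_of_mem_roots hα.1
  have hA : ((LieAlgebra.ad ℂ E e) ^ 3) x = 0 := by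
    by_contra h0
    refine hbound 3 (by norm_num) ?_
    have := mem_roots_of_ne_zero (ad_pow_mem_rootSpace he hx 3) h0
    rwa [← natCast_zsmul] at this
  have hB : ((LieAlgebra.ad ℂ E f) ^ 3) x = 0 := by
    by_contra h0
    refine hbound (-3) (by norm_num) ?_
    have := mem_roots_of_ne_zero (ad_pow_mem_rootSpace hf hx 3) h0
    rwa [smul_neg, ← natCast_zsmul, ← neg_smul] at this
  refine hx0 (eq_zero_of_ad_pow_eq_zero he hf (b := 0) (by simp [hσ.2]) hx hA hB ?_)
  intro i _ j
  rw [zero_mul, add_zero, T.dualForm_comm]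
  exact mul_ne_zero hef hne

theorem add_mem_nonisotropicRoots (hσ : σ ∈ T.isotropicRoots)
    (hα : α ∈ T.nonisotropicRoots) (h : α + σ ∈ T.roots) : α + σ ∈ T.nonisotropicRoots := by
  refine ⟨h, ?_⟩
  have h0 := dualForm_isotropic_nonisotropic hσ hα
  simpa [dualForm_add_left, dualForm_add_right, hσ.2, h0, T.dualForm_comm σ α] using hα.2

theorem lie_core_eq_zero (h : ∀ α ∈ T.nonisotropicRoots, ∀ z ∈ T.rootSpace α, ⁅x, z⁆ = 0)
    (hy : y ∈ T.core) : ⁅x, y⁆ = 0 := by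
  induction hy using LieSubalgebra.lieSpan_induction with
  | mem z hz =>
    obtain ⟨α, hα, hz⟩ := hz
    exact h α hα z hz
  | zero => simp
  | smul c z _ hz => rw [lie_smul, hz, smul_zero]
  | add y z _ _ hy hz => rw [lie_add, hy, hz, add_zero]
  | lie y z _ _ hy hz => rw [leibniz_lie, hy, hz, zero_lie, lie_zero, add_zero]

/-- On generators the degrees cannot cancel, `-σ` being isotropic; on brackets `(x, [y, z]) = ([x,
y], z) = 0`. -/
theorem form_core_eq_zero (hσ : σ ∈ T.isotropicRoots) (hx : x ∈ T.rootSpace σ)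
    (h : ∀ α ∈ T.nonisotropicRoots, ∀ z ∈ T.rootSpace α, ⁅x, z⁆ = 0) (hy : y ∈ T.core) :
    T.form x y = 0 := by
  induction hy using LieSubalgebra.lieSpan_induction with
  | mem z hz =>
    obtain ⟨α, hα, hz⟩ := hz
    refine form_eq_zero hx hz fun h0 => hα.2 ?_
    obtain rfl : α = -σ := (neg_eq_of_add_eq_zero_right h0).symm
    simp [dualForm_neg_left, dualForm_neg_right, hσ.2]
  | zero => simp
  | smul c z _ hz => rw [map_smul, hz, smul_zero]
  | add y z _ _ hy hz => rw [map_add, hy, hz, add_zero]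
  | lie y z hy _ _ _ =>
    rw [← T.form_invariant, lie_core_eq_zero h hy, map_zero, LinearMap.zero_apply]

/-- Otherwise `E_σ` and `E_{-σ}` both centralise the core. By tameness `E_{-σ}` lies in the core, to
which `E_σ` is orthogonal, against the non-degenerate pairing of the two. -/
theorem exists_nonisotropic_translate (hσ : σ ∈ T.isotropicRoots) :
    ∃ α ∈ T.nonisotropicRoots, α + σ ∈ T.nonisotropicRoots := by
  by_contra! hcon
  have key (τ : Dual ℂ T.H) (hτ : τ ∈ T.isotropicRoots)
      (hτ' : ∀ α ∈ T.nonisotropicRoots, α + τ ∉ T.nonisotropicRoots) :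
      ∀ x ∈ T.rootSpace τ, ∀ α ∈ T.nonisotropicRoots, ∀ z ∈ T.rootSpace α, ⁅x, z⁆ = 0 := by
    intro x hx α hα z hz
    by_contra h0
    have := mem_roots_of_ne_zero (lie_mem_rootSpace hx hz) h0
    rw [add_comm] at this
    exact hτ' α hα (add_mem_nonisotropicRoots hτ hα this)
  have hσ' : -σ ∈ T.isotropicRoots :=
    ⟨neg_mem_roots hσ.1, by simp [dualForm_neg_left, dualForm_neg_right, hσ.2]⟩
  have hneg : ∀ α ∈ T.nonisotropicRoots, α + -σ ∉ T.nonisotropicRoots := by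
    intro α hα h
    exact hcon _ h (by simpa using hα)
  obtain ⟨x, hx, hx0⟩ := exists_ne_zero_of_mem_roots hσ.1
  obtain ⟨y, hy, hxy⟩ := exists_form_ne_zero hx hx0
  have hycore : y ∈ T.core :=
    T.tame y fun z hz => lie_core_eq_zero (key (-σ) hσ' hneg y hy) hz
  exact hxy (form_core_eq_zero hσ hx (key σ hσ hcon x hx) hycore)

end ExtendedAffine

/-! ### Subspaces on which `Ψ` acts through a character. -/

namespace SplitTriple

variable {E : Type*} [LieRing E] [LieAlgebra ℂ E] (T : SplitTriple E) {α β : Dual ℂ T.H}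
  {x y : E} {Ψ : E ≃ₗ⁅ℂ⁆ E} {χ : Dual ℂ T.H → ℂˣ}

/-- The part of `E_β` on which `Ψ` acts as `χ(β)`. -/
def scalarSpace (Ψ : E ≃ₗ⁅ℂ⁆ E) (χ : Dual ℂ T.H → ℂˣ) (β : Dual ℂ T.H) : Submodule ℂ E where
  carrier := {x | x ∈ T.rootSpace β ∧ Ψ x = (χ β : ℂ) • x}
  add_mem' := fun {x y} hx hy => ⟨add_mem hx.1 hy.1, by rw [map_add, hx.2, hy.2, smul_add]⟩
  zero_mem' := ⟨zero_mem _, by simp⟩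
  smul_mem' := fun c x hx =>
    ⟨Submodule.smul_mem _ c hx.1, by rw [map_smul, hx.2, smul_comm]⟩

/-- `χ` restricts to a character of the root lattice. -/
def IsLatticeCharacter (χ : Dual ℂ T.H → ℂˣ) : Prop :=
  ∀ a ∈ T.rootLattice, ∀ b ∈ T.rootLattice, χ (a + b) = χ a * χ b

variable {T}

theorem mem_rootLattice (hα : α ∈ T.roots) : α ∈ T.rootLattice := Submodule.subset_span hα

theorem IsLatticeCharacter.map_zero (hχ : T.IsLatticeCharacter χ) : χ 0 = 1 := by
  have h := hχ 0 (zero_mem _) 0 (zero_mem _)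
  simpa using h

theorem IsLatticeCharacter.lie_mem_scalarSpace (hχ : T.IsLatticeCharacter χ)
    (hα : α ∈ T.rootLattice) (hβ : β ∈ T.rootLattice)
    (hx : x ∈ T.scalarSpace Ψ χ α) (hy : y ∈ T.scalarSpace Ψ χ β) :
    ⁅x, y⁆ ∈ T.scalarSpace Ψ χ (α + β) := by
  refine ⟨lie_mem_rootSpace hx.1 hy.1, ?_⟩
  rw [LieEquiv.map_lie, hx.2, hy.2, smul_lie, lie_smul, smul_smul, hχ α hα β hβ, Units.val_mul]

theorem IsLatticeCharacter.ad_pow_mem_scalarSpace (hχ : T.IsLatticeCharacter χ)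
    (hα : α ∈ T.rootLattice) (hβ : β ∈ T.rootLattice)
    (hx : x ∈ T.scalarSpace Ψ χ α) (hy : y ∈ T.scalarSpace Ψ χ β) (n : ℕ) :
    ((LieAlgebra.ad ℂ E x) ^ n) y ∈ T.scalarSpace Ψ χ (β + n • α) := by
  induction n with
  | zero => simpa using hy
  | succ n ih =>
    rw [pow_succ', Module.End.mul_apply, LieAlgebra.ad_apply,
      show β + (n + 1) • α = α + (β + n • α) by rw [succ_nsmul]; abel]
    exact hχ.lie_mem_scalarSpace hα (add_mem hβ (Submodule.smul_of_tower_mem _ n hα)) hx ih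

theorem IsCartanAutomorphism.apply_mem_rootSpace (hΨ : T.IsCartanAutomorphism Ψ)
    (hx : x ∈ T.rootSpace α) : Ψ x ∈ T.rootSpace α := by
  intro h
  rw [← hΨ h h.2, ← LieEquiv.map_lie, hx h, map_smul]

/-- The sum of the spaces `scalarSpace` is graded. -/
theorem mem_scalarSpace_of_mem_iSup (hx : x ∈ ⨆ β, T.scalarSpace Ψ χ β)
    (hxα : x ∈ T.rootSpace α) : x ∈ T.scalarSpace Ψ χ α := by
  have hle : ⨆ β, T.scalarSpace Ψ χ β ≤
      T.scalarSpace Ψ χ α ⊔ ⨆ β, ⨆ (_ : β ≠ α), T.rootSpace β := by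
    refine iSup_le fun β => ?_
    by_cases h : β = α
    · subst h
      exact le_sup_left
    · exact le_sup_of_le_right (le_iSup₂_of_le β h fun x hx => hx.1)
  obtain ⟨a, ha, b, hb, rfl⟩ := Submodule.mem_sup.1 (hle hx)
  have hbα : b ∈ T.rootSpace α := by simpa using Submodule.sub_mem _ hxα ha.1
  rw [Submodule.disjoint_def.1 (iSupIndep_rootSpace (T := T) α) b hbα hb, add_zero]
  exact ha

theorem IsLatticeCharacter.core_le_iSup_scalarSpace (hχ : T.IsLatticeCharacter χ)
    (h : ∀ α ∈ T.nonisotropicRoots, T.rootSpace α ≤ T.scalarSpace Ψ χ α) (hx : x ∈ T.core) :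
    x ∈ ⨆ β, T.scalarSpace Ψ χ β := by
  -- The index is restricted to the lattice, where `χ` is multiplicative, so that the sum is closed
  -- under brackets.
  suffices hx' : x ∈ ⨆ β : T.rootLattice, T.scalarSpace Ψ χ β from
    iSup_le (fun β : T.rootLattice => le_iSup (T.scalarSpace Ψ χ) (β : Dual ℂ T.H)) hx'
  induction hx using LieSubalgebra.lieSpan_induction with
  | mem z hz =>
    obtain ⟨α, hα, hz⟩ := hz
    exact Submodule.mem_iSup_of_mem (⟨α, mem_rootLattice hα.1⟩ : T.rootLattice) (h α hα hz)
  | zero => exact zero_mem _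
  | smul c z _ hz => exact Submodule.smul_mem _ c hz
  | add y z _ _ hy hz => exact add_mem hy hz
  | lie y z _ _ hy hz =>
    refine Submodule.iSup_induction _ (motive := fun a => ⁅a, z⁆ ∈
      ⨆ β : T.rootLattice, T.scalarSpace Ψ χ β) hy (fun β a ha => ?_) ?_ fun a b ha hb => ?_
    · refine Submodule.iSup_induction _ (motive := fun b => ⁅a, b⁆ ∈
        ⨆ β : T.rootLattice, T.scalarSpace Ψ χ β) hz (fun γ b hb => ?_) ?_ fun b c hb hc => ?_
      · exact Submodule.mem_iSup_of_mem (β + γ : T.rootLattice)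
          (hχ.lie_mem_scalarSpace β.2 γ.2 ha hb)
      · rw [lie_zero]
        exact zero_mem _
      · rw [lie_add]
        exact add_mem hb hc
    · rw [zero_lie]
      exact zero_mem _
    · rw [add_lie]
      exact add_mem ha hb

end SplitTriple

/-! ### Propagation of the character from a reflectable base to all roots. -/

namespace ExtendedAffine

open SplitTriple

variable {E : Type*} [LieRing E] [LieAlgebra ℂ E] {T : ExtendedAffine E} {α β σ : Dual ℂ T.H}
  {x y : E} {Ψ : E ≃ₗ⁅ℂ⁆ E} {χ : Dual ℂ T.H → ℂˣ}

theorem exists_scalar (hΨ : T.IsCartanAutomorphism Ψ) (hα : α ∈ T.nonisotropicRoots) :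
    ∃ c : ℂˣ, ∀ x ∈ T.rootSpace α, Ψ x = (c : ℂ) • x := by
  obtain ⟨e, he, he0⟩ := exists_ne_zero_of_mem_roots hα.1
  obtain ⟨c, hc⟩ := exists_eq_smul hα he he0 (hΨ.apply_mem_rootSpace he)
  have hc0 : c ≠ 0 := by
    rintro rfl
    rw [zero_smul] at hc
    exact he0 (Ψ.injective (hc.trans (map_zero Ψ).symm))
  refine ⟨Units.mk0 c hc0, fun x hx => ?_⟩
  obtain ⟨d, rfl⟩ := exists_eq_smul hα he he0 hx
  rw [map_smul, hc, Units.val_mk0, smul_comm]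

/-- `[e, f]` is a nonzero multiple of `t_α ∈ H`, which `Ψ` fixes, so the scalars on `E_α` and
`E_{-α}` are inverse to each other. -/
theorem rootSpace_neg_le_scalarSpace (hΨ : T.IsCartanAutomorphism Ψ)
    (hχ : T.IsLatticeCharacter χ) (hα : α ∈ T.nonisotropicRoots)
    (h : T.rootSpace α ≤ T.scalarSpace Ψ χ α) :
    T.rootSpace (-α) ≤ T.scalarSpace Ψ χ (-α) := by
  obtain ⟨c, hc⟩ := exists_scalar hΨ (neg_mem_nonisotropicRoots hα)
  obtain ⟨e, he, he0⟩ := exists_ne_zero_of_mem_roots hα.1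
  obtain ⟨f, hf, hef⟩ := exists_form_ne_zero he he0
  have ht0 : (T.t α : E) ≠ 0 := fun h0 => hα.2 (by rw [dualForm, h0, map_zero])
  have hne : ⁅e, f⁆ ≠ 0 := by
    rw [lie_eq_form_smul_t he hf]
    exact smul_ne_zero hef ht0
  have hfix : Ψ ⁅e, f⁆ = ⁅e, f⁆ := by
    rw [lie_eq_form_smul_t he hf, map_smul, hΨ _ (T.t α).2]
  rw [LieEquiv.map_lie, (h he).2, hc f hf, smul_lie, lie_smul, smul_smul] at hfix
  have h1 : (χ α : ℂ) * c = 1 := by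
    have := smul_left_injective ℂ hne (hfix.trans (one_smul ℂ _).symm)
    exact this
  have h2 : χ α * χ (-α) = 1 := by
    rw [← hχ α (mem_rootLattice hα.1) (-α) (neg_mem (mem_rootLattice hα.1)), add_neg_cancel,
      hχ.map_zero]
  have h3 : c = χ (-α) := mul_left_cancel ((Units.ext h1 : χ α * c = 1).trans h2.symm)
  intro x hx
  exact ⟨hx, h3 ▸ hc x hx⟩

theorem sub_nsmul_mem_nonisotropicRoots (hα : α ∈ T.nonisotropicRoots)
    (hβ : β ∈ T.nonisotropicRoots) {n : ℕ} (hn : 2 * T.dualForm α β = n * T.dualForm α α) :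
    β + n • -α ∈ T.nonisotropicRoots := by
  obtain ⟨e, he, he0⟩ := exists_ne_zero_of_mem_roots hα.1
  obtain ⟨f, hf, hef⟩ := exists_dual_vector hα he he0
  obtain ⟨x, hx, hx0⟩ := exists_ne_zero_of_mem_roots hβ.1
  refine ⟨mem_roots_of_ne_zero (ad_pow_mem_rootSpace hf hx n)
    (ad_pow_ne_zero hα he hf hef hx hx0 hn), ?_⟩
  convert hβ.2 using 1
  rw [← Nat.cast_smul_eq_nsmul ℂ]
  simp only [dualForm_add_left, dualForm_add_right, dualForm_smul_left, dualForm_smul_right,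
    dualForm_neg_left, dualForm_neg_right, T.dualForm_comm β α]
  linear_combination -(n : ℂ) * hn

/-- The target line is spanned by `(ad f)^n x`, on which `Ψ` acts as `χ(β) χ(-α)^n`. -/
theorem rootSpace_sub_nsmul_le_scalarSpace (hΨ : T.IsCartanAutomorphism Ψ)
    (hχ : T.IsLatticeCharacter χ) (hα : α ∈ T.nonisotropicRoots)
    (hβ : β ∈ T.nonisotropicRoots) (hα' : T.rootSpace α ≤ T.scalarSpace Ψ χ α)
    (hβ' : T.rootSpace β ≤ T.scalarSpace Ψ χ β) {n : ℕ}
    (hn : 2 * T.dualForm α β = n * T.dualForm α α) :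
    T.rootSpace (β + n • -α) ≤ T.scalarSpace Ψ χ (β + n • -α) := by
  obtain ⟨e, he, he0⟩ := exists_ne_zero_of_mem_roots hα.1
  obtain ⟨f, hf, hef⟩ := exists_dual_vector hα he he0
  obtain ⟨x, hx, hx0⟩ := exists_ne_zero_of_mem_roots hβ.1
  intro y hy
  obtain ⟨c, rfl⟩ := exists_eq_smul (sub_nsmul_mem_nonisotropicRoots hα hβ hn)
    (ad_pow_mem_rootSpace hf hx n) (ad_pow_ne_zero hα he hf hef hx hx0 hn) hy
  exact Submodule.smul_mem _ c (hχ.ad_pow_mem_scalarSpace (neg_mem (mem_rootLattice hα.1))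
    (mem_rootLattice hβ.1) (rootSpace_neg_le_scalarSpace hΨ hχ hα hα' hf) (hβ' hx) n)

/-- A reflection is the subtraction of a natural multiple of `α` or of `-α`. -/
theorem exists_reflection_eq (hα : α ∈ T.nonisotropicRoots) (hβ : β ∈ T.nonisotropicRoots) :
    ∃ γ, ∃ n : ℕ, (γ = α ∨ γ = -α) ∧ 2 * T.dualForm γ β = n * T.dualForm γ γ ∧
      T.reflection α hα.2 β = β + n • -γ := by
  obtain ⟨z, hz⟩ := exists_int_two_mul_dualForm hα hβ.1
  have hr : T.reflection α hα.2 β = β - (z : ℂ) • α := by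
    rw [SplitTriple.reflection_apply, hz, mul_div_cancel_right₀ _ hα.2]
  obtain ⟨n, rfl | rfl⟩ := z.eq_nat_or_neg
  · refine ⟨α, n, Or.inl rfl, by simpa using hz, ?_⟩
    rw [hr, smul_neg, ← sub_eq_add_neg, Int.cast_natCast, Nat.cast_smul_eq_nsmul]
  · refine ⟨-α, n, Or.inr rfl, ?_, ?_⟩
    · simp only [dualForm_neg_left, dualForm_neg_right]
      push_cast at hz
      linear_combination -hz
    · rw [hr, neg_neg, Int.cast_neg, Int.cast_natCast, neg_smul, sub_neg_eq_add,
        Nat.cast_smul_eq_nsmul]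

theorem reflection_mem_nonisotropicRoots (hα : α ∈ T.nonisotropicRoots)
    (hβ : β ∈ T.nonisotropicRoots) : T.reflection α hα.2 β ∈ T.nonisotropicRoots := by
  obtain ⟨γ, n, hγ, hn, h⟩ := exists_reflection_eq hα hβ
  rw [h]
  refine sub_nsmul_mem_nonisotropicRoots ?_ hβ hn
  obtain rfl | rfl := hγ
  · exact hα
  · exact neg_mem_nonisotropicRoots hα

theorem rootSpace_reflection_le_scalarSpace (hΨ : T.IsCartanAutomorphism Ψ)
    (hχ : T.IsLatticeCharacter χ) (hα : α ∈ T.nonisotropicRoots)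
    (hβ : β ∈ T.nonisotropicRoots) (hα' : T.rootSpace α ≤ T.scalarSpace Ψ χ α)
    (hβ' : T.rootSpace β ≤ T.scalarSpace Ψ χ β) :
    T.rootSpace (T.reflection α hα.2 β) ≤ T.scalarSpace Ψ χ (T.reflection α hα.2 β) := by
  obtain ⟨γ, n, hγ, hn, h⟩ := exists_reflection_eq hα hβ
  rw [h]
  obtain rfl | rfl := hγ
  · exact rootSpace_sub_nsmul_le_scalarSpace hΨ hχ hα hβ hα' hβ' hn
  · exact rootSpace_sub_nsmul_le_scalarSpace hΨ hχ (neg_mem_nonisotropicRoots hα) hβ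
      (rootSpace_neg_le_scalarSpace hΨ hχ hα hα') hβ' hn

variable {P : Set (Dual ℂ T.H)}

/-- Reflections in `P` subtract integer multiples of elements of `P`, so `R^×` lies in the span;
isotropic roots are differences of elements of `R^×`. -/
theorem span_eq_rootLattice (hP : T.IsReflectableBase P) :
    Submodule.span ℤ P = T.rootLattice := by
  have hnon : T.nonisotropicRoots ⊆ Submodule.span ℤ P := by
    intro β hβ
    rw [← hP.2.1] at hβ
    obtain ⟨w, hw, α, hα, rfl⟩ := hβ
    refine (weylGroup_apply_mem (S := {β | β ∈ T.nonisotropicRoots ∧ β ∈ Submodule.span ℤ P})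
      (fun α hα _ β hβ => ⟨reflection_mem_nonisotropicRoots (hP.1 hα) hβ.1, ?_⟩) hw
      ⟨hP.1 hα, Submodule.subset_span hα⟩).2
    obtain ⟨γ, n, hγ, -, h⟩ := exists_reflection_eq (hP.1 hα) hβ.1
    rw [h]
    refine add_mem hβ.2 (Submodule.smul_of_tower_mem _ n (neg_mem ?_))
    obtain rfl | rfl := hγ
    · exact Submodule.subset_span hα
    · exact neg_mem (Submodule.subset_span hα)
  refine le_antisymm (Submodule.span_mono fun α hα => (hP.1 hα).1) ?_
  refine Submodule.span_le.2 fun σ hσ => ?_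
  by_cases h0 : T.dualForm σ σ = 0
  · obtain ⟨α, hα, hασ⟩ := exists_nonisotropic_translate ⟨hσ, h0⟩
    simpa using sub_mem (hnon hασ) (hnon hα)
  · exact hnon ⟨hσ, h0⟩

theorem rootSpace_le_scalarSpace_of_nonisotropic (hP : T.IsReflectableBase P)
    (hΨ : T.IsCartanAutomorphism Ψ) (hχ : T.IsLatticeCharacter χ)
    (h : ∀ α ∈ P, T.rootSpace α ≤ T.scalarSpace Ψ χ α) (hβ : β ∈ T.nonisotropicRoots) :
    T.rootSpace β ≤ T.scalarSpace Ψ χ β := by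
  rw [← hP.2.1] at hβ
  obtain ⟨w, hw, α, hα, rfl⟩ := hβ
  exact (weylGroup_apply_mem
    (S := {β | β ∈ T.nonisotropicRoots ∧ T.rootSpace β ≤ T.scalarSpace Ψ χ β})
    (fun α hα _ β hβ => ⟨reflection_mem_nonisotropicRoots (hP.1 hα) hβ.1,
      rootSpace_reflection_le_scalarSpace hΨ hχ (hP.1 hα) hβ.1 (h α hα) hβ.2⟩) hw
    ⟨hP.1 hα, h α hα⟩).2

/-- For a Jordan block `f^m u = c^m u + m c^(m-1) v`, and `m ≠ 0` in `ℂ`. -/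
theorem eq_zero_of_apply_eq_smul_add {M : Type*} [AddCommGroup M] [Module ℂ M] {f : M →ₗ[ℂ] M}
    {m : ℕ} (hm : 0 < m) (hf : (⇑f)^[m] = id) {c : ℂ} {u v : M}
    (hu : f u = c • u + v) (hv : f v = c • v) : v = 0 := by
  have h1 (k : ℕ) : (⇑f)^[k] v = c ^ k • v := by
    induction k with
    | zero => simp
    | succ k ih => rw [Function.iterate_succ_apply', ih, map_smul, hv, smul_smul, pow_succ]
  -- The extra factor `c` avoids the exponent `k - 1`.
  have h2 (k : ℕ) : c • (⇑f)^[k] u = c ^ (k + 1) • u + (k * c ^ k) • v := by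
    induction k with
    | zero => simp
    | succ k ih =>
      rw [Function.iterate_succ_apply', ← map_smul, ih, map_add, map_smul, map_smul, hu, hv]
      push_cast
      module
  by_contra hv0
  have hcm : c ^ m = 1 := by
    have h := h1 m
    rw [hf, id] at h
    exact (smul_left_injective ℂ hv0 ((one_smul ℂ v).trans h)).symm
  have h := h2 m
  rw [hf, id, pow_succ, hcm, one_mul, mul_one, left_eq_add] at h
  exact hv0 ((smul_eq_zero.1 h).resolve_left (by exact_mod_cast hm.ne'))

theorem rootSpace_le_scalarSpace (hΨ : T.IsCartanAutomorphism Ψ) (hfin : IsFiniteOrder Ψ)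
    (hχ : T.IsLatticeCharacter χ)
    (h : ∀ α ∈ T.nonisotropicRoots, T.rootSpace α ≤ T.scalarSpace Ψ χ α) (hσ : σ ∈ T.roots) :
    T.rootSpace σ ≤ T.scalarSpace Ψ χ σ := by
  by_cases h0 : T.dualForm σ σ = 0
  swap
  · exact h σ ⟨hσ, h0⟩
  intro x hx
  refine ⟨hx, sub_eq_zero.1 ?_⟩
  have hy : Ψ x - (χ σ : ℂ) • x ∈ T.rootSpace σ :=
    sub_mem (hΨ.apply_mem_rootSpace hx) (Submodule.smul_mem _ _ hx)
  have hcentral : ∀ α ∈ T.nonisotropicRoots, ∀ z ∈ T.rootSpace α,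
      ⁅Ψ x - (χ σ : ℂ) • x, z⁆ = 0 := by
    intro α hα z hz
    -- A nonzero `[x, z]` has non-isotropic degree `α + σ`, where `Ψ` is already known; cancelling
    -- `χ(α)` then gives `[Ψx, z] = χ(σ)[x, z]`.
    have h1 : Ψ ⁅x, z⁆ = (χ σ * χ α : ℂ) • ⁅x, z⁆ := by
      by_cases hxz : ⁅x, z⁆ = 0
      · rw [hxz, map_zero, smul_zero]
      · have hmem := lie_mem_rootSpace hx hz
        have hr := mem_roots_of_ne_zero hmem hxz
        rw [add_comm] at hr
        have h2 := (h _ (add_mem_nonisotropicRoots ⟨hσ, h0⟩ hα hr)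
          (by rwa [add_comm] at hmem)).2
        rwa [hχ α (mem_rootLattice hα.1) σ (mem_rootLattice hσ), mul_comm, Units.val_mul] at h2
    rw [LieEquiv.map_lie, (h α hα hz).2, lie_smul, mul_comm, mul_smul] at h1
    have h2 := smul_right_injective E (χ α).ne_zero h1
    rw [sub_lie, smul_lie, sub_eq_zero]
    exact h2
  have hcore := T.tame _ fun y hy => lie_core_eq_zero hcentral hy
  have hyχ := mem_scalarSpace_of_mem_iSup (hχ.core_le_iSup_scalarSpace h hcore) hy
  obtain ⟨m, hm, hΨm⟩ := hfin
  exact eq_zero_of_apply_eq_smul_add (f := (Ψ : E →ₗ[ℂ] E)) hm hΨm (u := x)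
    (add_sub_cancel _ _).symm hyχ.2

/-- Since `toNat` sends `⊤` to `0`, index zero alone would allow `refl(R) = ⊤` in rank `0`. Type
`B_ℓ` provides a nonzero root, so the rank is positive and the infimum is attained. -/
theorem exists_reflectableBase_encard_eq {l : ℕ} (hB : T.IsTypeB l) (hind : T.index = 0) :
    ∃ P, T.IsReflectableBase P ∧ P.encard = Module.finrank ℤ T.rootLattice := by
  have := T.rootLattice_free
  have := T.rootLattice_finite
  have h : T.refl.toNat = Module.finrank ℤ T.rootLattice := by
    have := hind
    rw [index] at this
    omega
  have hpos : Module.finrank ℤ T.rootLattice ≠ 0 := by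
    intro h0
    have hsub : Subsingleton T.rootLattice := Module.finrank_zero_iff.1 h0
    obtain ⟨α, hα⟩ := nonisotropicRoots_nonempty hB
    have hα0 : α = 0 := congrArg Subtype.val
      (Subsingleton.elim (⟨α, mem_rootLattice hα.1⟩ : T.rootLattice) 0)
    exact hα.2 (by rw [dualForm_eq, hα0, LinearMap.zero_apply])
  have htop : T.refl ≠ ⊤ := by
    intro h0
    rw [h0] at h
    exact hpos h.symm
  have hrefl : T.refl = ⨅ P : {P : Set (Dual ℂ T.H) | T.IsReflectableBase P}, P.1.encard := by
    rw [SplitTriple.refl, iInf_subtype]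
  have hne : Nonempty {P : Set (Dual ℂ T.H) | T.IsReflectableBase P} := by
    by_contra hcon
    rw [not_nonempty_iff] at hcon
    exact htop (by rw [hrefl, iInf_of_empty])
  obtain ⟨⟨P, hP⟩, hPe⟩ := ciInf_mem
    fun P : {P : Set (Dual ℂ T.H) | T.IsReflectableBase P} => P.1.encard
  refine ⟨P, hP, ?_⟩
  rw [← h, ENat.natCast_toNat htop, hrefl]
  exact hPe

/-- `Ψ` acts on the root spaces through a character of the root lattice. -/
theorem exists_latticeCharacter {l : ℕ} (hB : T.IsTypeB l) (hind : T.index = 0)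
    (hfin : IsFiniteOrder Ψ) (hΨ : T.IsCartanAutomorphism Ψ) :
    ∃ χ, T.IsLatticeCharacter χ ∧
      ∀ α ∈ T.roots, ∀ x ∈ T.rootSpace α, Ψ x = (χ α : ℂ) • x := by
  have := T.rootLattice_free
  have := T.rootLattice_finite
  obtain ⟨P, hP, hcard⟩ := exists_reflectableBase_encard_eq hB hind
  have hspan := span_eq_rootLattice hP
  have hg (α : Dual ℂ T.H) : ∃ c : ℂˣ, α ∈ P → ∀ x ∈ T.rootSpace α, Ψ x = (c : ℂ) • x := by
    by_cases hα : α ∈ P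
    · obtain ⟨c, hc⟩ := exists_scalar hΨ (hP.1 hα)
      exact ⟨c, fun _ => hc⟩
    · exact ⟨1, fun h => absurd h hα⟩
  choose g hg using hg
  obtain ⟨χ, hχ, hχP⟩ := exists_character hspan
    (linearIndependent_of_span_eq_of_encard_eq hspan hcard) g
  have hnon := fun β => rootSpace_le_scalarSpace_of_nonisotropic (β := β) hP hΨ hχ
    fun α hα x hx => ⟨hx, by rw [hχP α hα]; exact hg α hα x hx⟩
  exact ⟨χ, hχ, fun α hα x hx => (rootSpace_le_scalarSpace hΨ hfin hχ hnon hα hx).2⟩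

end ExtendedAffine

/-! ### Uniqueness and existence of the associated map. -/

namespace SplitTriple

variable {E : Type*} [LieRing E] [LieAlgebra ℂ E] {T : SplitTriple E} {Ψ : E ≃ₗ⁅ℂ⁆ E}
  {χ : Dual ℂ T.H → ℂˣ}

/-- Whichever `α` is chosen, `χ(α + σ) χ(-α) = χ(σ)`. -/
theorem IsAssociatedMap.eq_latticeCharacter (hχ : T.IsLatticeCharacter χ)
    (h : ∀ α ∈ T.roots, ∀ x ∈ T.rootSpace α, Ψ x = (χ α : ℂ) • x) {ψ : T.roots → ℂˣ}
    (hψ : T.IsAssociatedMap Ψ ψ) : ψ = fun α : T.roots => χ α := by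
  have hnon (α : T.roots) (hα : (α : Dual ℂ T.H) ∈ T.nonisotropicRoots) : ψ α = χ α := by
    obtain ⟨x, hx, hx0⟩ := exists_ne_zero_of_mem_roots α.2
    have h1 := (hψ.1 α hα x hx).symm.trans (h α α.2 x hx)
    exact Units.ext (smul_left_injective ℂ hx0 h1)
  funext σ
  by_cases h0 : T.dualForm σ σ = 0
  · obtain ⟨α, α', β, hα, hβ, hα', hβα, hσ⟩ := hψ.2 σ ⟨σ.2, h0⟩
    rw [hσ, hnon β hβ, hnon α' (hα' ▸ neg_mem_nonisotropicRoots hα),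
      ← hχ _ (mem_rootLattice β.2) _ (mem_rootLattice α'.2), hβα, hα']
    congr 1
    abel
  · exact hnon σ ⟨σ.2, h0⟩

end SplitTriple

theorem ExtendedAffine.isAssociatedMap_latticeCharacter {E : Type*} [LieRing E] [LieAlgebra ℂ E]
    {T : ExtendedAffine E} {Ψ : E ≃ₗ⁅ℂ⁆ E} {χ : Dual ℂ T.H → ℂˣ} (hχ : T.IsLatticeCharacter χ)
    (h : ∀ α ∈ T.roots, ∀ x ∈ T.rootSpace α, Ψ x = (χ α : ℂ) • x) :
    T.IsAssociatedMap Ψ fun α : T.roots => χ α := by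
  refine ⟨fun α _ => h α α.2, fun σ hσ => ?_⟩
  obtain ⟨α, hα, hασ⟩ := ExtendedAffine.exists_nonisotropic_translate hσ
  refine ⟨⟨α, hα.1⟩, ⟨-α, SplitTriple.neg_mem_roots hα.1⟩, ⟨α + σ, hασ.1⟩, hα, hασ, rfl, rfl, ?_⟩
  rw [← hχ _ (SplitTriple.mem_rootLattice hασ.1) _
    (neg_mem (SplitTriple.mem_rootLattice hα.1))]
  exact congrArg χ (by abel)

end EALA

theorem mainTheorem4 {E : Type*} [LieRing E] [LieAlgebra ℂ E] (T : EALA.ExtendedAffine E)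
    (l : ℕ) (hB : T.IsTypeB l) (hind : T.index = 0)
    (Ψ : E ≃ₗ⁅ℂ⁆ E) (hfin : EALA.IsFiniteOrder Ψ) (hcart : T.IsCartanAutomorphism Ψ) :
    T.IsDiagonal Ψ ∧
      (∃! ψ : T.roots → ℂˣ, T.IsAssociatedMap Ψ ψ) ∧
      ∀ ψ : T.roots → ℂˣ, T.IsAssociatedMap Ψ ψ →
        (∀ α : T.roots, ∀ x ∈ T.rootSpace α, Ψ x = (ψ α : ℂ) • x) ∧ T.IsCharacter ψ := by
  obtain ⟨χ, hχ, h⟩ := EALA.ExtendedAffine.exists_latticeCharacter hB hind hfin hcart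
  refine ⟨fun α hα => ⟨χ α, h α hα⟩,
    ⟨fun α => χ α, EALA.ExtendedAffine.isAssociatedMap_latticeCharacter hχ h,
      fun ψ hψ => hψ.eq_latticeCharacter hχ h⟩, fun ψ hψ => ?_⟩
  rw [hψ.eq_latticeCharacter hχ h]
  refine ⟨fun α => h α α.2, fun α β γ hγ => ?_⟩
  simp only [hγ]
  exact hχ _ (EALA.SplitTriple.mem_rootLattice α.2) _ (EALA.SplitTriple.mem_rootLattice β.2)
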